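/- Let $\mathcal H$, $\mathcal G$ be complex Hilbert spaces, and let $\mathfrak h$ be a closed, non-negative, densely defined quadratic form in $\mathcal H$ (we use the same letter for its sesquilinear form, linear in the first argument). Let $\mathcal H^1=\operatorname{dom}\mathfrak h$ with norm $\|f\|_1^2=\|f\|^2+\mathfrak h(f)$. Let $\Gamma:\mathcal H^1\to\mathcal G$ be bounded with $\mathcal G^{1/2}:=\operatorname{ran}\Gamma$ dense in $\mathcal G$, so that $(\Gamma,\mathcal G)$ is a boundary pair associated with $\mathfrak h$; it is not required that $\ker\Gamma$ be dense in $\mathcal H$. *Notation.* Let $\mathcal H^{1,D}=\ker\Gamma$ with the norm of $\mathcal H^1$, let $\iota:\mathcal H^{1,D}\to\mathcal H^1$ be the inclusion, and let $\mathcal H^{0,D}$ be the closure of $\ker\Gamma$ in $\mathcal H$. The Neumann operator $H^N$ is the operator in $\mathcal H$ associated with $\mathfrak h$, and the Dirichlet operator $H^D$ is the operator in $\mathcal H^{0,D}$ associated with $\mathfrak h|_{\ker\Gamma}$. Put $R^N(z)=(H^N-z)^{-1}$ and $R^D(z)=(H^D-z)^{-1}$, the latter extended by $0$ on $(\mathcal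 H^{0,D})^\perp$. For a Hilbert space $E=\mathcal H^1,\mathcal H^{1,D},\mathcal G^{1/2}$ denote by $\mathcal H^{-1},\mathcal H^{-1,D},\mathcal G^{-1/2}$ the space of bounded antilinear functionals on $E$; $f\in\mathcal H$ is identified with $\langle f,\cdot\rangle\in\mathcal H^{-1}$ and $\psi\in\mathcal G$ with $\langle\psi,\cdot\rangle\in\mathcal G^{-1/2}$. For a bounded $T:E\to F$ the dual $T^*$ is $(T^*u)(v)=u(Tv)$. The weak operators $\tilde H^N-z:\mathcal H^1\to\mathcal H^{-1}$ and $\tilde H^D-z:\mathcal H^{1,D}\to\mathcal H^{-1,D}$ are both given by $u\mapsto(\mathfrak h-z)(u,\cdot)$, where $(\mathfrak h-z)(u,v)=\mathfrak h(u,v)-z\langle u,v\rangle$, and $\tilde R^N(z)$, $\tilde R^D(z)$ are their inverses. Let $\mathcal L^1(z)=\{u\in\mathcal H^1:(\mathfrak h-z)(u,f)=0\ \ \forall f\in\ker\Gamma\}$, let $P(z)$ be the projection of $\mathcal H^1$ onto $\mathcal L^1(z)$ along $\ker\Gamma$, and let $S(z)=(\Gamma|_{\mathcal L^1(z)})^{-1}:\mathcal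 G^{1/2}\to\mathcal H^1$. With $S=S(-1)$, $\mathcal G^{1/2}$ carries the norm $\|\varphi\|_{1/2}=\|S\varphi\|_{1}$. Let $\mathfrak l_z(\varphi,\psi)=(\mathfrak h-z)(S(z)\varphi,S\psi)$ on $\mathcal G^{1/2}$, let $\tilde\Lambda(z):\mathcal G^{1/2}\to\mathcal G^{-1/2}$, $\varphi\mapsto\mathfrak l_z(\varphi,\cdot)$, be the weak Dirichlet-to-Neumann operator, and let $\Lambda(z)$ be the operator in $\mathcal G$ associated with $\mathfrak l_z$. The pair is elliptically regular if $\|S\varphi\|_{\mathcal H}\le C\|\varphi\|_{\mathcal G}$ for some $C>0$ and all $\varphi\in\mathcal G^{1/2}$. **Theorem.** Let $z\in\mathbb C\setminus(\operatorname{spec}H^D\cup\operatorname{spec}H^N)$. Then $\tilde H^N-z$, $\tilde H^D-z$, $\tilde\Lambda(z)$ and $\Gamma:\mathcal L^1(w)\to\mathcal G^{1/2}$ for $w\in\{z,\bar z\}$ are invertible with bounded inverses, $\mathcal H^1$ is the topological direct sum of $\mathcal L^1(z)$ and $\ker\Gamma$, and the weak Krein formula holds: $$\tilde R^N(z)-\iota\tilde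 R^D(z)\iota^*=P(z)\tilde R^N(z)=S(z)\tilde\Lambda(z)^{-1}S(\bar z)^*:\ \mathcal H^{-1}\to\mathcal H^1 .$$ In particular, $$R^N(z)-R^D(z)=S(z)\tilde\Lambda(z)^{-1}S(\bar z)^*:\ \mathcal H\to\mathcal G^{-1/2}\to\mathcal G^{1/2}\to\mathcal H .$$ If, in addition, the boundary pair is elliptically regular, then $S(z)$ and $S(\bar z)$ extend to bounded operators $\overline{S}(z),\overline{S}(\bar z):\mathcal G\to\mathcal H$, the operator $\Lambda(z)$ has a bounded inverse $\Lambda(z)^{-1}:\mathcal G\to\mathcal G$, which is the restriction of $\tilde\Lambda(z)^{-1}$ to $\mathcal G$, and, with $\overline{S}(\bar z)^*$ the Hilbert space adjoint, $$R^N(z)-R^D(z)=\overline{S}(z)\,\Lambda(z)^{-1}\,\overline{S}(\bar z)^*:\ \mathcal H\to\mathcal G\to\mathcal G\to\mathcal H .$$ -/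

import Mathlib

open Filter Topology ComplexConjugate

noncomputable section

namespace BoundaryPairs

/-! ### Unbounded operators: associated operator of a form, spectrum, resolvent

Sesquilinear forms follow Mathlib's convention: `a v u` is conjugate-linear in `v` and linear
in `u`.  What is written `a(u, v)` with the linear argument first is `a v u` here. -/

section Operators

variable {K : Type*} [NormedAddCommGroup K] [InnerProductSpace ℂ K]

/-- `E⁻`, the space of bounded conjugate-linear functionals on `E`. -/
abbrev AntiDual (E : Type*) [NormedAddCommGroup E] [NormedSpace ℂ E] : Type _ := E →L⋆[ℂ] ℂ

/-- The dual `T* : F⁻ → E⁻`, `(T* u)(v) = u (T v)`, of a bounded operator `T : E → F`. -/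
def dualMap {E F : Type*} [NormedAddCommGroup E] [NormedSpace ℂ E]
    [NormedAddCommGroup F] [NormedSpace ℂ F] (T : E →L[ℂ] F) : AntiDual F →L[ℂ] AntiDual E :=
  (ContinuousLinearMap.compSL E F ℂ (RingHom.id ℂ) (starRingEnd ℂ)).flip T

/-- The weak operator `E → E⁻`, `u ↦ a(u, ·)`, of a bounded sesquilinear form on `E`. -/
def weakOp {E : Type*} [NormedAddCommGroup E] [NormedSpace ℂ E] (a : E →L⋆[ℂ] E →L[ℂ] ℂ) :
    E →L[ℂ] AntiDual E :=
  a.flip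

/-- For a bounded operator `J : E → K`, the map `K → E⁻`, `f ↦ ⟨f, J ·⟩`. If `J` is a dense
embedding, this is the embedding of `K` in the scale `E ↪ K ↪ E⁻`. -/
def pivot {E : Type*} [NormedAddCommGroup E] [NormedSpace ℂ E] (J : E →L[ℂ] K) :
    K →L[ℂ] AntiDual E :=
  dualMap J ∘L (innerSLFlip ℂ)

/-- The graph of the operator in `K` associated with a form `a` on `E`, where `E` is regarded as
a subspace of `K` through `J`: all pairs `(x, y)` with `x = J w` for some `w ∈ E` such that
`a(w, v) = ⟨y, J v⟩` for all `v ∈ E`. -/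
def assocGraph {E : Type*} [NormedAddCommGroup E] [NormedSpace ℂ E] (J : E →L[ℂ] K)
    (a : E →L⋆[ℂ] E →L[ℂ] ℂ) : Submodule ℂ (K × K) where
  carrier := {p | ∃ w : E, J w = p.1 ∧ ∀ v : E, a v w = inner ℂ (J v) p.2}
  add_mem' := by
    rintro p p' ⟨w, hw, h⟩ ⟨w', hw', h'⟩
    exact ⟨w + w', by simp [hw, hw'], fun v => by simp [h, h']⟩
  zero_mem' := ⟨0, by simp, fun v => by simp⟩
  smul_mem' := by
    rintro c p ⟨w, hw, h⟩
    exact ⟨c • w, by simp [hw], fun v => by simp [h]⟩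

/-- For an injective `J` with dense range, the associated graph is the graph of an operator. -/
theorem assocGraph_functional {E : Type*} [NormedAddCommGroup E] [NormedSpace ℂ E]
    (J : E →L[ℂ] K) (a : E →L⋆[ℂ] E →L[ℂ] ℂ) (hJ : Function.Injective J) (hd : DenseRange J) :
    ∀ p ∈ assocGraph J a, p.1 = 0 → p.2 = 0 := by
  rintro ⟨x, y⟩ ⟨w, hw, h⟩ hx
  simp only at hw h hx ⊢
  have hw0 : w = 0 := hJ (by rw [hw, hx, map_zero])
  refine hd.eq_zero_of_inner_right ℂ (fun e => ?_)
  rw [← h e, hw0, map_zero]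

/-- The operator in `K` associated with a form `a` on `E`, where `E` is regarded as a dense
subspace of `K` through the injective map `J`. -/
def assocOp {E : Type*} [NormedAddCommGroup E] [NormedSpace ℂ E] (J : E →L[ℂ] K)
    (a : E →L⋆[ℂ] E →L[ℂ] ℂ) : K →ₗ.[ℂ] K :=
  (assocGraph J a).toLinearPMap

/-- `R` is the bounded, everywhere defined inverse of `A - z`. -/
def IsResolvent (A : K →ₗ.[ℂ] K) (z : ℂ) (R : K →L[ℂ] K) : Prop :=
  (∀ f : K, ∃ hf : R f ∈ A.domain, A ⟨R f, hf⟩ - z • R f = f) ∧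
    ∀ x : A.domain, R (A x - z • (x : K)) = x

/-- The spectrum of an unbounded operator. -/
def spec (A : K →ₗ.[ℂ] K) : Set ℂ := {z | ¬ ∃ R : K →L[ℂ] K, IsResolvent A z R}

open Classical in
/-- The resolvent `(A - z)⁻¹` (and `0` for `z` in the spectrum). -/
def resolv (A : K →ₗ.[ℂ] K) (z : ℂ) : K →L[ℂ] K :=
  if h : ∃ R : K →L[ℂ] K, IsResolvent A z R then h.choose else 0

end Operators

/-! ### Closed forms and their domains -/

/-- A closed, non-negative, densely defined quadratic form in `H` (given with its polarization;
`form v u` is conjugate-linear in `v` and linear in `u`). -/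
structure ClosedForm (H : Type*) [NormedAddCommGroup H] [InnerProductSpace ℂ H] where
  dom : Submodule ℂ H
  dense_dom : Dense (dom : Set H)
  form : dom →ₗ⋆[ℂ] dom →ₗ[ℂ] ℂ
  symm : ∀ u v, conj (form v u) = form u v
  nonneg : ∀ u, 0 ≤ (form u u).re
  closed : ∀ (u : ℕ → dom) (x : H), Tendsto (fun n => (u n : H)) atTop (𝓝 x) →
    (∀ ε > 0, ∃ N, ∀ m ≥ N, ∀ n ≥ N, (form (u m - u n) (u m - u n)).re < ε) →
    ∃ y : dom, (y : H) = x ∧ Tendsto (fun n => (form (u n - y) (u n - y)).re) atTop (𝓝 0)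

namespace ClosedForm

variable {H : Type*} [NormedAddCommGroup H] [InnerProductSpace ℂ H] (q : ClosedForm H)

/-- The Hilbert space `H¹ = dom h` with `‖f‖₁² = ‖f‖² + h(f)`. -/
def H1 : Type _ := q.dom

instance : AddCommGroup q.H1 := inferInstanceAs (AddCommGroup q.dom)

instance : Module ℂ q.H1 := inferInstanceAs (Module ℂ q.dom)

/-- The inclusion of `H¹` in `H`, as a linear map. -/
def inclₗ : q.H1 →ₗ[ℂ] H := q.dom.subtype

/-- The form on `H¹`, as a sesquilinear map. -/
def formₗ : q.H1 →ₗ⋆[ℂ] q.H1 →ₗ[ℂ] ℂ := q.form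

/-- The inner product of `H¹`. -/
abbrev core : InnerProductSpace.Core ℂ q.H1 where
  inner u v := inner ℂ (q.inclₗ u) (q.inclₗ v) + q.formₗ u v
  conj_inner_symm u v := by
    rw [map_add, inner_conj_symm]
    exact congrArg _ (q.symm u v)
  re_inner_nonneg u := by
    rw [map_add]
    exact add_nonneg inner_self_nonneg (q.nonneg u)
  add_left u v w := by
    simp only [map_add, inner_add_left, LinearMap.add_apply]
    ring
  smul_left u v r := by
    simp only [map_smulₛₗ, inner_smul_left, LinearMap.smul_apply, RingHom.id_apply, smul_eq_mul]
    ring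
  definite u hu := by
    have h1 : RCLike.re (inner ℂ (q.inclₗ u) (q.inclₗ u)) + (q.formₗ u u).re = 0 := by
      have := congrArg Complex.re hu
      simpa using this
    have h2 : 0 ≤ (q.formₗ u u).re := q.nonneg u
    have h3 : 0 ≤ RCLike.re (inner ℂ (q.inclₗ u) (q.inclₗ u)) := inner_self_nonneg
    have h4 : RCLike.re (inner ℂ (q.inclₗ u) (q.inclₗ u)) = 0 := by linarith
    rw [inner_self_eq_norm_sq] at h4
    have h5 : q.inclₗ u = 0 := by simpa using h4
    exact Subtype.ext h5

instance : NormedAddCommGroup q.H1 := q.core.toNormedAddCommGroup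

instance : InnerProductSpace ℂ q.H1 := InnerProductSpace.ofCore q.core.toCore

theorem inner_H1 (u v : q.H1) :
    inner ℂ u v = inner ℂ (q.inclₗ u) (q.inclₗ v) + q.formₗ u v := rfl

theorem norm_sq_H1 (u : q.H1) : ‖u‖ ^ 2 = ‖q.inclₗ u‖ ^ 2 + (q.formₗ u u).re := by
  rw [← inner_self_eq_norm_sq (𝕜 := ℂ) u, inner_H1, map_add, inner_self_eq_norm_sq]
  rfl

theorem norm_incl_le (u : q.H1) : ‖q.inclₗ u‖ ≤ ‖u‖ := by
  have h := q.norm_sq_H1 u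
  have h2 : 0 ≤ (q.formₗ u u).re := q.nonneg u
  exact (sq_le_sq₀ (norm_nonneg _) (norm_nonneg _)).1 (by linarith)

instance [CompleteSpace H] : CompleteSpace q.H1 := by
  refine Metric.complete_of_cauchySeq_tendsto (fun u hu => ?_)
  have hlip : UniformContinuous q.inclₗ :=
    (q.inclₗ.mkContinuous 1 (fun u => by simpa using q.norm_incl_le u)).uniformContinuous
  obtain ⟨x, hx⟩ := cauchySeq_tendsto_of_complete (hlip.comp_cauchySeq hu)
  have hform : ∀ ε > 0, ∃ N, ∀ m ≥ N, ∀ n ≥ N,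
      (q.formₗ (u m - u n) (u m - u n)).re < ε := by
    intro ε hε
    obtain ⟨N, hN⟩ := Metric.cauchySeq_iff.1 hu (Real.sqrt ε) (Real.sqrt_pos.2 hε)
    refine ⟨N, fun m hm n hn => ?_⟩
    have h1 := hN m hm n hn
    rw [dist_eq_norm] at h1
    have h2 : ‖u m - u n‖ ^ 2 < ε := by
      calc ‖u m - u n‖ ^ 2 < Real.sqrt ε ^ 2 := by gcongr
        _ = ε := Real.sq_sqrt hε.le
    have h3 := q.norm_sq_H1 (u m - u n)
    nlinarith [sq_nonneg ‖q.inclₗ (u m - u n)‖]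
  obtain ⟨y, hy, hlim⟩ := q.closed u x hx hform
  let y' : q.H1 := y
  refine ⟨y', ?_⟩
  rw [tendsto_iff_norm_sub_tendsto_zero]
  have hx' : Tendsto (fun n => q.inclₗ (u n)) atTop (𝓝 (q.inclₗ y')) := by
    have : q.inclₗ y' = x := hy
    rw [this]; exact hx
  have h0 : Tendsto (fun n => ‖q.inclₗ (u n - y')‖ ^ 2) atTop (𝓝 0) := by
    have := (tendsto_iff_norm_sub_tendsto_zero.1 hx').pow 2
    simpa [map_sub] using this
  have h1 : Tendsto (fun n => ‖u n - y'‖ ^ 2) atTop (𝓝 0) := by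
    have h2 : Tendsto (fun n => (q.formₗ (u n - y') (u n - y')).re) atTop (𝓝 0) := hlim
    have := h0.add h2
    simp only [add_zero] at this
    refine this.congr (fun n => ?_)
    exact (q.norm_sq_H1 _).symm
  have h2 := h1.sqrt
  simpa [Real.sqrt_sq] using h2

/-- The bounded inclusion `H¹ ↪ H`. -/
def incl : q.H1 →L[ℂ] H := q.inclₗ.mkContinuous 1 (fun u => by simpa using q.norm_incl_le u)

/-- The bounded sesquilinear form `h` on `H¹`. -/
def h : q.H1 →L⋆[ℂ] q.H1 →L[ℂ] ℂ :=
  LinearMap.mkContinuous₂ q.formₗ 2 (fun u v => by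
    have h1 : q.formₗ u v = inner ℂ u v - inner ℂ (q.inclₗ u) (q.inclₗ v) := by
      rw [inner_H1]; ring
    rw [h1]
    calc ‖inner ℂ u v - inner ℂ (q.inclₗ u) (q.inclₗ v)‖
        ≤ ‖inner ℂ u v‖ + ‖inner ℂ (q.inclₗ u) (q.inclₗ v)‖ := norm_sub_le _ _
      _ ≤ ‖u‖ * ‖v‖ + ‖q.inclₗ u‖ * ‖q.inclₗ v‖ :=
          add_le_add (norm_inner_le_norm _ _) (norm_inner_le_norm _ _)
      _ ≤ ‖u‖ * ‖v‖ + ‖u‖ * ‖v‖ := by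
          gcongr
          · exact q.norm_incl_le u
          · exact q.norm_incl_le v
      _ = 2 * ‖u‖ * ‖v‖ := by ring)

/-- The form `h - z 𝟏` on `H¹`: `(h - z 𝟏)(u, v) = h(u, v) - z ⟨u, v⟩`. -/
def hz (z : ℂ) : q.H1 →L⋆[ℂ] q.H1 →L[ℂ] ℂ :=
  q.h - z • (innerSL ℂ).bilinearComp q.incl q.incl

/-- The Neumann operator: the operator in `H` associated with `h`. -/
def neumannOp : H →ₗ.[ℂ] H := assocOp q.incl q.h

/-- The resolvent `R^N(z) = (H^N - z)⁻¹` in `H`. -/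
def RN (z : ℂ) : H →L[ℂ] H := resolv q.neumannOp z

/-- The extended Neumann operator shifted by `z`, as a map `H¹ → H⁻¹`. -/
def weakNeumann (z : ℂ) : q.H1 →L[ℂ] AntiDual q.H1 := weakOp (q.hz z)

/-- The extended resolvent of the Neumann operator, `H⁻¹ → H¹`. -/
def wRN (z : ℂ) : AntiDual q.H1 →L[ℂ] q.H1 := (q.weakNeumann z).inverse

end ClosedForm

/-! ### The range of a boundary map with its natural norm -/

section Trace

variable {E G : Type*} [NormedAddCommGroup E] [InnerProductSpace ℂ E]
  [NormedAddCommGroup G] [InnerProductSpace ℂ G]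

/-- `G^{1/2}`, the range of the boundary map `Γ`; its norm is defined below and is not that
of `G`. -/
def GHalf (Γ : E →L[ℂ] G) : Type _ := LinearMap.range (Γ : E →ₗ[ℂ] G)

variable (Γ : E →L[ℂ] G)

instance : AddCommGroup (GHalf Γ) :=
  inferInstanceAs (AddCommGroup (LinearMap.range (Γ : E →ₗ[ℂ] G)))

instance : Module ℂ (GHalf Γ) :=
  inferInstanceAs (Module ℂ (LinearMap.range (Γ : E →ₗ[ℂ] G)))

/-- The boundary map as a map onto its range. -/
def toRangeₗ : E →ₗ[ℂ] GHalf Γ := (Γ : E →ₗ[ℂ] G).rangeRestrict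

/-- The inclusion of `G^{1/2}` in `G`, as a linear map. -/
def inclGₗ : GHalf Γ →ₗ[ℂ] G := (LinearMap.range (Γ : E →ₗ[ℂ] G)).subtype

theorem inclGₗ_toRangeₗ (u : E) : inclGₗ Γ (toRangeₗ Γ u) = Γ u := rfl

theorem toRangeₗ_eq_zero {u : E} : toRangeₗ Γ u = 0 ↔ Γ u = 0 := by
  rw [← inclGₗ_toRangeₗ]
  exact (map_eq_zero_iff (inclGₗ Γ) Subtype.val_injective).symm

variable [CompleteSpace E]

instance : CompleteSpace (LinearMap.ker (Γ : E →ₗ[ℂ] G)) :=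
  (ContinuousLinearMap.isClosed_ker Γ).completeSpace_coe

/-- The bijection `Γ : (ker Γ)ᗮ → ran Γ`. -/
def traceEquiv : (LinearMap.ker (Γ : E →ₗ[ℂ] G))ᗮ ≃ₗ[ℂ] GHalf Γ :=
  LinearEquiv.ofBijective (toRangeₗ Γ ∘ₗ (LinearMap.ker (Γ : E →ₗ[ℂ] G))ᗮ.subtype) <| by
    constructor
    · rw [← LinearMap.ker_eq_bot, LinearMap.ker_eq_bot']
      intro u hu
      have h1 : (u : E) ∈ LinearMap.ker (Γ : E →ₗ[ℂ] G) := (toRangeₗ_eq_zero Γ).1 hu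
      have h2 := Submodule.inner_right_of_mem_orthogonal h1 u.2
      exact Subtype.ext (inner_self_eq_zero.1 h2)
    · rintro ⟨_, u, rfl⟩
      obtain ⟨a, ha, b, hb, hab⟩ :=
        (LinearMap.ker (Γ : E →ₗ[ℂ] G)).exists_add_mem_mem_orthogonal u
      refine ⟨⟨b, hb⟩, Subtype.ext ?_⟩
      change Γ b = Γ u
      have ha' : Γ a = 0 := ha
      rw [hab, map_add, ha', zero_add]

/-- The Dirichlet solution map `S = S(-1)`: `S φ` is the unique `u ∈ (ker Γ)ᗮ` with `Γ u = φ`. -/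
def solₗ : GHalf Γ →ₗ[ℂ] E :=
  (LinearMap.ker (Γ : E →ₗ[ℂ] G))ᗮ.subtype ∘ₗ (traceEquiv Γ).symm.toLinearMap

theorem solₗ_injective : Function.Injective (solₗ Γ) :=
  Subtype.val_injective.comp (traceEquiv Γ).symm.injective

/-- The norm `‖φ‖_{1/2} = ‖S φ‖` of `G^{1/2}`. -/
instance : NormedAddCommGroup (GHalf Γ) :=
  NormedAddCommGroup.induced (GHalf Γ) E (solₗ Γ) (solₗ_injective Γ)

instance : InnerProductSpace ℂ (GHalf Γ) := InnerProductSpace.induced (solₗ Γ)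

theorem norm_solₗ (φ : GHalf Γ) : ‖solₗ Γ φ‖ = ‖φ‖ := rfl

/-- The Dirichlet solution map `S = S(-1) : G^{1/2} → E` as a bounded operator. -/
def sol : GHalf Γ →L[ℂ] E :=
  (solₗ Γ).mkContinuous 1 (fun φ => by rw [norm_solₗ, one_mul])

theorem toRangeₗ_sol (φ : GHalf Γ) : toRangeₗ Γ (sol Γ φ) = φ :=
  (traceEquiv Γ).apply_symm_apply φ

theorem sol_mem (φ : GHalf Γ) : sol Γ φ ∈ (LinearMap.ker (Γ : E →ₗ[ℂ] G))ᗮ :=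
  ((traceEquiv Γ).symm φ).2

theorem apply_sol (φ : GHalf Γ) : Γ (sol Γ φ) = inclGₗ Γ φ :=
  congrArg (inclGₗ Γ) (toRangeₗ_sol Γ φ)

theorem norm_toRangeₗ_le (u : E) : ‖toRangeₗ Γ u‖ ≤ ‖u‖ := by
  have hs : ‖toRangeₗ Γ u‖ = ‖sol Γ (toRangeₗ Γ u)‖ := rfl
  set s := sol Γ (toRangeₗ Γ u) with hsdef
  have hk : u - s ∈ LinearMap.ker (Γ : E →ₗ[ℂ] G) := by
    change Γ (u - s) = 0
    rw [map_sub, hsdef, apply_sol, inclGₗ_toRangeₗ, sub_self]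
  have horth : inner ℂ (u - s) s = 0 :=
    Submodule.inner_right_of_mem_orthogonal hk (sol_mem Γ _)
  have h1 := norm_add_sq_eq_norm_sq_add_norm_sq_of_inner_eq_zero (𝕜 := ℂ) (u - s) s horth
  rw [sub_add_cancel] at h1
  rw [hs]
  nlinarith [norm_nonneg u, norm_nonneg s, norm_nonneg (u - s)]

/-- The boundary map as a bounded map `Γ : E → G^{1/2}`. -/
def toRange : E →L[ℂ] GHalf Γ :=
  (toRangeₗ Γ).mkContinuous 1 (fun u => by rw [one_mul]; exact norm_toRangeₗ_le Γ u)

/-- The bounded inclusion `G^{1/2} ↪ G`. -/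
def inclG : GHalf Γ →L[ℂ] G :=
  (inclGₗ Γ).mkContinuous ‖Γ‖ (fun φ => by
    rw [← apply_sol, ← norm_solₗ]
    exact Γ.le_opNorm _)

end Trace

/-! ### Dirichlet operator, weak solutions and Dirichlet-to-Neumann operators -/

section Pair

variable {H G : Type*} [NormedAddCommGroup H] [InnerProductSpace ℂ H] [CompleteSpace H]
  [NormedAddCommGroup G] [InnerProductSpace ℂ G] (q : ClosedForm H) (Γ : q.H1 →L[ℂ] G)

/-- `H^{1,D} = ker Γ`, with the norm of `H¹`. -/
abbrev H1D : Submodule ℂ q.H1 := LinearMap.ker (Γ : q.H1 →ₗ[ℂ] G)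

/-- `ι : H^{1,D} ↪ H¹`. -/
def iota : H1D q Γ →L[ℂ] q.H1 := (H1D q Γ).subtypeL

/-- `H^{0,D}`, the closure of `ker Γ` in `H`. It is all of `H` if `ker Γ` is dense in `H`. -/
def H0D : Submodule ℂ H := ((H1D q Γ).map (q.incl : q.H1 →ₗ[ℂ] H)).topologicalClosure

instance : CompleteSpace (H0D q Γ) :=
  Submodule.topologicalClosure.completeSpace _

/-- The inclusion `H^{1,D} ↪ H^{0,D}`. -/
def inclD : H1D q Γ →L[ℂ] H0D q Γ :=
  (q.incl ∘L iota q Γ).codRestrict (H0D q Γ) (fun u =>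
    Submodule.le_topologicalClosure _ (Submodule.mem_map_of_mem u.2))

/-- The form `h^D`, the restriction of `h` to `H^{1,D}`. -/
def hD : H1D q Γ →L⋆[ℂ] H1D q Γ →L[ℂ] ℂ := q.h.bilinearComp (iota q Γ) (iota q Γ)

/-- The form `h^D - z 𝟏` on `H^{1,D}`. -/
def hDz (z : ℂ) : H1D q Γ →L⋆[ℂ] H1D q Γ →L[ℂ] ℂ :=
  hD q Γ - z • (innerSL ℂ).bilinearComp (inclD q Γ) (inclD q Γ)

/-- The Dirichlet operator: the operator in `H^{0,D}` associated with `h^D`. -/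
def dirichletOp : H0D q Γ →ₗ.[ℂ] H0D q Γ := assocOp (inclD q Γ) (hD q Γ)

/-- The resolvent `R^D(z) = (H^D - z)⁻¹`, extended by `0` on the orthogonal complement of
`H^{0,D}` in `H`. -/
def RD (z : ℂ) : H →L[ℂ] H :=
  (H0D q Γ).subtypeL ∘L resolv (dirichletOp q Γ) z ∘L (H0D q Γ).orthogonalProjectionOnto

/-- The extended Dirichlet operator shifted by `z`, as a map `H^{1,D} → H^{-1,D}`. -/
def weakDirichlet (z : ℂ) : H1D q Γ →L[ℂ] AntiDual (H1D q Γ) := weakOp (hDz q Γ z)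

/-- The extended resolvent of the Dirichlet operator, `H^{-1,D} → H^{1,D}`. -/
def wRD (z : ℂ) : AntiDual (H1D q Γ) →L[ℂ] H1D q Γ := (weakDirichlet q Γ z).inverse

/-- The weak solutions `L¹(z)`: all `u ∈ H¹` with `(h - z 𝟏)(u, f) = 0` for `f ∈ ker Γ`. -/
def L1 (z : ℂ) : Submodule ℂ q.H1 where
  carrier := {u | ∀ f ∈ H1D q Γ, q.hz z f u = 0}
  add_mem' := fun hu hv f hf => by rw [map_add, hu f hf, hv f hf, add_zero]
  zero_mem' := fun f _ => map_zero _
  smul_mem' := fun c u hu f hf => by rw [map_smul, hu f hf, smul_zero]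

open Classical in
/-- The projection `P(z)` of `H¹` onto `L¹(z)` along `ker Γ` (and `0` if `H¹` is not the
topological direct sum of the two). -/
def P (z : ℂ) : q.H1 →L[ℂ] q.H1 :=
  if hc : (L1 q Γ z).IsTopCompl (H1D q Γ) then (L1 q Γ z).projectionL (H1D q Γ) hc else 0

/-- The restriction `Γ : L¹(z) → G^{1/2}`. -/
def traceOn (z : ℂ) : L1 q Γ z →L[ℂ] GHalf Γ := toRange Γ ∘L (L1 q Γ z).subtypeL

/-- The Dirichlet solution operator `S(z) = (Γ|_{L¹(z)})⁻¹ : G^{1/2} → H¹`. -/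
def S (z : ℂ) : GHalf Γ →L[ℂ] q.H1 := (L1 q Γ z).subtypeL ∘L (traceOn q Γ z).inverse

/-- The Dirichlet-to-Neumann form `l_z(φ, ψ) = (h - z 𝟏)(S(z) φ, S ψ)` on `G^{1/2}`. -/
def dtnForm (z : ℂ) : GHalf Γ →L⋆[ℂ] GHalf Γ →L[ℂ] ℂ :=
  (q.hz z).bilinearComp (sol Γ) (S q Γ z)

/-- The weak Dirichlet-to-Neumann operator `G^{1/2} → G^{-1/2}`, `φ ↦ l_z(φ, ·)`. -/
def weakDtN (z : ℂ) : GHalf Γ →L[ℂ] AntiDual (GHalf Γ) := weakOp (dtnForm q Γ z)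

/-- The (strong) Dirichlet-to-Neumann operator: the operator in `G` associated with `l_z`. -/
def DtN (z : ℂ) : G →ₗ.[ℂ] G := assocOp (inclG Γ) (dtnForm q Γ z)

/-- The boundary pair is elliptically regular: `‖S φ‖_H ≤ C ‖φ‖_G` on `G^{1/2}`. -/
def EllipticallyRegular : Prop :=
  ∃ C > 0, ∀ φ : GHalf Γ, ‖q.incl (sol Γ φ)‖ ≤ C * ‖inclG Γ φ‖

end Pair

end BoundaryPairs

end

/-!
The weak operator of a form `a - z` on a Hilbert space `E` differs from the Riesz isomorphism
`E → E⁻` by a multiple of `J* J`, where `J : E → K` is the embedding. A resolvent at `z` of the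
operator associated with `a` therefore yields invertibility of the weak operator
(`weakOp_isInvertible_of_notMem_spec`), and conversely the strong resolvent is the part of the weak
inverse in `K` (`isResolvent_of_weakOp_isInvertible`). This is applied to the Neumann and the
Dirichlet form, and, in the converse direction at the point `0`, to the Dirichlet-to-Neumann form.

Solving the weak Dirichlet problem gives `P(z) = 1 - ι R̃ᴰ(z) ι* (H̃ᴺ - z)`, hence the decomposition
of `H¹`, the invertibility of the trace on `L¹(z)`, and the first equality of Krein's formula. By
passing to adjoint forms (`weakOp_isInvertible_of_conj`) the same holds at `z̄`.

For the second equality, `Γ* Λ̃(z) = (H̃ᴺ - z) S(z)` (`dualMap_toRange_weakDtN`) shows that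
`Γ R̃ᴺ(z) Γ*` inverts `Λ̃(z)`. Green's identity `Λ̃(z) Γ u = S(z̄)* (H̃ᴺ - z) u` (`weakDtN_toRange`),
read with `u = R̃ᴺ(z) l`, says `Λ̃(z)⁻¹ S(z̄)* = Γ R̃ᴺ(z)`, and `S(z) Γ = P(z)`.

Under elliptic regularity, `S(z) φ = S φ + (z + 1) Rᴰ(z) S φ` in `H` (`incl_S`) bounds `S(z)` in the
norm of the boundary space, so that `S(z)` extends by density. -/

noncomputable section

namespace BoundaryPairs

section Operators

variable {K : Type*} [NormedAddCommGroup K] [InnerProductSpace ℂ K]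

theorem dualMap_apply {E F : Type*} [NormedAddCommGroup E] [NormedSpace ℂ E]
    [NormedAddCommGroup F] [NormedSpace ℂ F] (T : E →L[ℂ] F) (u : AntiDual F) (v : E) :
    dualMap T u v = u (T v) := rfl

theorem weakOp_apply {E : Type*} [NormedAddCommGroup E] [NormedSpace ℂ E]
    (a : E →L⋆[ℂ] E →L[ℂ] ℂ) (u v : E) : weakOp a u v = a v u := rfl

theorem pivot_apply {E : Type*} [NormedAddCommGroup E] [NormedSpace ℂ E] (J : E →L[ℂ] K)
    (f : K) (v : E) : pivot J f v = inner ℂ (J v) f := rfl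

theorem isInvertible_of_bijective {E F : Type*} [NormedAddCommGroup E] [NormedSpace ℂ E]
    [CompleteSpace E] [NormedAddCommGroup F] [NormedSpace ℂ F] [CompleteSpace F]
    {T : E →L[ℂ] F} (hT : Function.Bijective T) : T.IsInvertible :=
  ⟨ContinuousLinearEquiv.ofBijective T (LinearMap.ker_eq_bot.2 hT.1)
    (LinearMap.range_eq_top.2 hT.2), ContinuousLinearEquiv.coe_ofBijective ..⟩

/-! ### Resolvents -/

theorem isResolvent_iff_graph {A : K →ₗ.[ℂ] K} {z : ℂ} {R : K →L[ℂ] K} :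
    IsResolvent A z R ↔
      (∀ f, (R f, f + z • R f) ∈ A.graph) ∧ ∀ x y, (x, y) ∈ A.graph → R (y - z • x) = x := by
  refine and_congr (forall_congr' fun f => ?_) ⟨fun h x y hxy => ?_, fun h x => ?_⟩
  · rw [LinearPMap.mem_graph_iff]
    constructor
    · rintro ⟨hf, h⟩
      exact ⟨⟨R f, hf⟩, rfl, sub_eq_iff_eq_add.1 h⟩
    · rintro ⟨⟨y, hy⟩, rfl, h⟩
      exact ⟨hy, sub_eq_iff_eq_add.2 h⟩
  · obtain ⟨x', rfl, rfl⟩ := (LinearPMap.mem_graph_iff A).1 hxy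
    exact h x'
  · exact h _ _ (A.mem_graph x)

theorem IsResolvent.unique {A : K →ₗ.[ℂ] K} {z : ℂ} {R R' : K →L[ℂ] K}
    (h : IsResolvent A z R) (h' : IsResolvent A z R') : R = R' := by
  ext f
  have := (isResolvent_iff_graph.1 h').2 _ _ ((isResolvent_iff_graph.1 h).1 f)
  rw [add_sub_cancel_right] at this
  exact this.symm

theorem IsResolvent.resolv_eq {A : K →ₗ.[ℂ] K} {z : ℂ} {R : K →L[ℂ] K}
    (h : IsResolvent A z R) : resolv A z = R := by
  have hex : ∃ R : K →L[ℂ] K, IsResolvent A z R := ⟨R, h⟩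
  rw [resolv, dif_pos hex]
  exact hex.choose_spec.unique h

/-! ### The operator of a form and its weak version -/

variable {E : Type*} [NormedAddCommGroup E]

section Normed

variable [NormedSpace ℂ E] {J : E →L[ℂ] K} {a : E →L⋆[ℂ] E →L[ℂ] ℂ}

theorem mem_graph_assocOp (hJ : Function.Injective J) (hd : DenseRange J) {x y : K} :
    (x, y) ∈ (assocOp J a).graph ↔ ∃ w : E, J w = x ∧ ∀ v : E, a v w = inner ℂ (J v) y := by
  rw [assocOp, Submodule.toLinearPMap_graph_eq _ (assocGraph_functional J a hJ hd)]
  rfl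

/-- If the weak operator of `a - z` is invertible, then the operator associated with `a` has a
resolvent at `z`, and it is the part of the weak inverse in `K`. -/
theorem isResolvent_of_weakOp_isInvertible (hJ : Function.Injective J) (hd : DenseRange J)
    {z : ℂ} (h : (weakOp (a - z • (innerSL ℂ).bilinearComp J J)).IsInvertible) :
    IsResolvent (assocOp J a) z
      (J ∘L (weakOp (a - z • (innerSL ℂ).bilinearComp J J)).inverse ∘L pivot J) := by
  rw [isResolvent_iff_graph]
  constructor
  · intro f
    rw [mem_graph_assocOp hJ hd]
    refine ⟨_, rfl, fun v => ?_⟩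
    have := congrArg (· v) (h.self_apply_inverse (pivot J f))
    simp only [weakOp_apply, pivot_apply, sub_apply, smul_apply, smul_eq_mul,
      ContinuousLinearMap.bilinearComp_apply, innerSL_apply_apply] at this
    rw [inner_add_right, inner_smul_right, ← this]
    exact (sub_add_cancel _ _).symm
  · intro x y hxy
    obtain ⟨w, rfl, hw⟩ := (mem_graph_assocOp hJ hd).1 hxy
    simp only [ContinuousLinearMap.comp_apply]
    congr 1
    rw [h.inverse_apply_eq]
    ext v
    simp only [weakOp_apply, pivot_apply, sub_apply, smul_apply, smul_eq_mul,
      ContinuousLinearMap.bilinearComp_apply, innerSL_apply_apply, hw, inner_sub_right,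
      inner_smul_right]

end Normed

variable [InnerProductSpace ℂ E] [CompleteSpace E]

/-- The Riesz isomorphism `E → E⁻`. -/
theorem innerSLFlip_bijective :
    Function.Bijective (innerSLFlip ℂ : E →L[ℂ] E →L⋆[ℂ] ℂ) := by
  constructor
  · intro x y h
    exact ext_inner_left ℂ fun v => congrArg (· v) h
  · intro l
    -- `conj ∘ l` is linear, and the linear Riesz theorem applies to it
    let l' : StrongDual ℂ E :=
      ((starL ℂ : ℂ ≃L⋆[ℂ] ℂ) : ℂ →L⋆[ℂ] ℂ).comp l
    refine ⟨(InnerProductSpace.toDual ℂ E).symm l', ?_⟩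
    ext v
    rw [innerSLFlip_apply_apply, ← inner_conj_symm, InnerProductSpace.toDual_symm_apply]
    exact Complex.conj_conj (l v)

/-- A form on a Hilbert space and its adjoint form have invertible weak operators at the same
time: through the Riesz isomorphism the two weak operators are adjoint to each other. -/
theorem weakOp_isInvertible_of_conj {a b : E →L⋆[ℂ] E →L[ℂ] ℂ}
    (hab : ∀ u v, b v u = conj (a u v)) (ha : (weakOp a).IsInvertible) :
    (weakOp b).IsInvertible := by
  obtain ⟨e, he⟩ := isInvertible_of_bijective (innerSLFlip_bijective (E := E))
  set T : E →L[ℂ] E := InnerProductSpace.continuousLinearMapOfBilin a with hT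
  have ha' : weakOp a = (e : E →L[ℂ] E →L⋆[ℂ] ℂ) ∘L T.adjoint := by
    ext u v
    rw [he]
    simp [weakOp_apply, hT, ContinuousLinearMap.adjoint_inner_right]
  have hb' : weakOp b = (e : E →L[ℂ] E →L⋆[ℂ] ℂ) ∘L T := by
    ext u v
    rw [he]
    simp only [weakOp_apply, hab, ContinuousLinearMap.comp_apply, innerSLFlip_apply_apply]
    rw [← inner_conj_symm, hT, InnerProductSpace.continuousLinearMapOfBilin_apply]
  rw [ha', ContinuousLinearMap.isInvertible_equiv_comp] at ha
  rw [hb', ContinuousLinearMap.isInvertible_equiv_comp]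
  refine ContinuousLinearMap.IsInvertible.of_inverse (g := T.adjoint.inverse.adjoint) ?_ ?_
  · have := congrArg ContinuousLinearMap.adjoint ha.inverse_comp_self
    rwa [ContinuousLinearMap.adjoint_comp, ContinuousLinearMap.adjoint_adjoint,
      ContinuousLinearMap.adjoint_id] at this
  · have := congrArg ContinuousLinearMap.adjoint ha.self_comp_inverse
    rwa [ContinuousLinearMap.adjoint_comp, ContinuousLinearMap.adjoint_adjoint,
      ContinuousLinearMap.adjoint_id] at this

/-- If the inner product of `E` is `⟨J ·, J ·⟩ + a`, and `z` is in the resolvent set of the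
operator associated with `a`, then the weak operator of `a - z` is invertible. -/
theorem weakOp_isInvertible_of_notMem_spec {J : E →L[ℂ] K} {a : E →L⋆[ℂ] E →L[ℂ] ℂ}
    (hJ : Function.Injective J) (hd : DenseRange J)
    (hin : ∀ u v : E, inner ℂ u v = inner ℂ (J u) (J v) + a u v)
    {z : ℂ} (hz : z ∉ spec (assocOp J a)) :
    (weakOp (a - z • (innerSL ℂ).bilinearComp J J)).IsInvertible := by
  obtain ⟨R, hR⟩ := not_not.1 hz
  obtain ⟨hR1, hR2⟩ := isResolvent_iff_graph.1 hR
  apply isInvertible_of_bijective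
  constructor
  · refine (injective_iff_map_eq_zero _).2 fun u hu => hJ ?_
    have h1 : (J u, z • J u) ∈ (assocOp J a).graph := by
      refine (mem_graph_assocOp hJ hd).2 ⟨u, rfl, fun v => ?_⟩
      have := congrArg (· v) hu
      simp only [weakOp_apply, sub_apply, smul_apply, smul_eq_mul, zero_apply,
        ContinuousLinearMap.bilinearComp_apply, innerSL_apply_apply] at this
      rw [inner_smul_right]
      exact sub_eq_zero.1 this
    have h2 := hR2 _ _ h1
    rw [sub_self, map_zero] at h2
    rw [← h2, map_zero]
  · intro l
    -- `u₀` solves the equation at `-1`; the error `(z + 1) ⟨J u₀, J ·⟩` is removed by `R`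
    obtain ⟨u₀, rfl⟩ := innerSLFlip_bijective.2 l
    obtain ⟨w, hw, hw'⟩ := (mem_graph_assocOp hJ hd).1 (hR1 ((z + 1) • J u₀))
    refine ⟨u₀ + w, ?_⟩
    ext v
    rw [weakOp_apply, map_add]
    simp only [sub_apply, smul_apply, smul_eq_mul,
        ContinuousLinearMap.bilinearComp_apply, innerSL_apply_apply, hw', ← hw,
        innerSLFlip_apply_apply, hin, inner_add_right, inner_smul_right]
    ring

end Operators

/-! ### The boundary space -/

section Trace

variable {E G : Type*} [NormedAddCommGroup E] [InnerProductSpace ℂ E] [CompleteSpace E]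
  [NormedAddCommGroup G] [InnerProductSpace ℂ G] (Γ : E →L[ℂ] G)

instance : CompleteSpace (GHalf Γ) := by
  let e : GHalf Γ ≃ₗᵢ[ℂ] (LinearMap.ker (Γ : E →ₗ[ℂ] G))ᗮ :=
    ⟨(traceEquiv Γ).symm, fun _ => rfl⟩
  exact e.toIsometryEquiv.completeSpace

theorem inclG_injective : Function.Injective (inclG Γ) := Subtype.val_injective

theorem toRange_sol (φ : GHalf Γ) : toRange Γ (sol Γ φ) = φ := toRangeₗ_sol Γ φ

theorem toRange_eq_zero {u : E} : toRange Γ u = 0 ↔ Γ u = 0 := toRangeₗ_eq_zero Γ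

theorem denseRange_inclG {Γ : E →L[ℂ] G} (hΓ : DenseRange Γ) : DenseRange (inclG Γ) := by
  refine hΓ.mono ?_
  rintro _ ⟨u, rfl⟩
  exact ⟨toRange Γ u, rfl⟩

end Trace

/-! ### The Neumann operator -/

namespace ClosedForm

variable {H : Type*} [NormedAddCommGroup H] [InnerProductSpace ℂ H] (q : ClosedForm H)

theorem incl_injective : Function.Injective q.incl := Subtype.val_injective

theorem denseRange_incl : DenseRange q.incl := by
  refine q.dense_dom.mono fun x hx => ⟨(⟨x, hx⟩ : q.dom), rfl⟩

theorem inner_eq (u v : q.H1) : inner ℂ u v = inner ℂ (q.incl u) (q.incl v) + q.h u v := rfl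

theorem hz_apply (z : ℂ) (v u : q.H1) :
    q.hz z v u = q.h v u - z * inner ℂ (q.incl v) (q.incl u) := rfl

theorem hz_conj (z : ℂ) (u v : q.H1) : q.hz (conj z) v u = conj (q.hz z u v) := by
  have h : conj (q.h u v) = q.h v u := q.symm v u
  rw [hz_apply, hz_apply, map_sub, map_mul, h, inner_conj_symm]

theorem weakNeumann_apply (z : ℂ) (u v : q.H1) : q.weakNeumann z u v = q.hz z v u := rfl

variable {q} {z : ℂ}

theorem weakNeumann_isInvertible [CompleteSpace H] (hN : z ∉ spec q.neumannOp) :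
    (q.weakNeumann z).IsInvertible :=
  weakOp_isInvertible_of_notMem_spec q.incl_injective q.denseRange_incl q.inner_eq hN

theorem RN_eq (h : (q.weakNeumann z).IsInvertible) : q.RN z = q.incl ∘L q.wRN z ∘L pivot q.incl :=
  (isResolvent_of_weakOp_isInvertible q.incl_injective q.denseRange_incl h).resolv_eq

end ClosedForm

section Pair

variable {H G : Type*} [NormedAddCommGroup H] [InnerProductSpace ℂ H]
  [NormedAddCommGroup G] [InnerProductSpace ℂ G] {q : ClosedForm H} {Γ : q.H1 →L[ℂ] G} {z : ℂ}

/-! ### The Dirichlet operator and weak solutions -/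

theorem inclD_injective : Function.Injective (inclD q Γ) := fun _ _ h =>
  Subtype.ext (q.incl_injective (congrArg (fun x : H0D q Γ => (x : H)) h))

theorem denseRange_inclD : DenseRange (inclD q Γ) := by
  rintro ⟨x, hx⟩
  rw [closure_subtype]
  refine closure_mono ?_ hx
  rintro _ ⟨u, hu, rfl⟩
  exact ⟨inclD q Γ ⟨u, hu⟩, ⟨_, rfl⟩, rfl⟩

theorem mem_L1_iff {u : q.H1} :
    u ∈ L1 q Γ z ↔ dualMap (iota q Γ) (q.weakNeumann z u) = 0 := by
  rw [ContinuousLinearMap.ext_iff]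
  exact ⟨fun h v => h v v.2, fun h f hf => h ⟨f, hf⟩⟩

variable (q Γ z) in
/-- The part of `u` in `ker Γ` along `L¹(z)`: the solution of the weak Dirichlet problem with the
same right-hand side as `u` (and `0` if the weak Dirichlet operator is
not invertible). -/
def dirichletPart : q.H1 →L[ℂ] H1D q Γ :=
  wRD q Γ z ∘L dualMap (iota q Γ) ∘L q.weakNeumann z

theorem dirichletPart_eq_zero (h : (weakDirichlet q Γ z).IsInvertible) {u : q.H1} :
    dirichletPart q Γ z u = 0 ↔ u ∈ L1 q Γ z := by
  rw [mem_L1_iff]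
  exact map_eq_zero_iff _ h.inverse.injective

theorem dirichletPart_iota (h : (weakDirichlet q Γ z).IsInvertible) (v : H1D q Γ) :
    dirichletPart q Γ z (iota q Γ v) = v :=
  h.inverse_apply_self v

theorem isTopCompl_L1 (h : (weakDirichlet q Γ z).IsInvertible) :
    (L1 q Γ z).IsTopCompl (H1D q Γ) := by
  have h1 : (dirichletPart q Γ z).ker = L1 q Γ z :=
    Submodule.ext fun u => dirichletPart_eq_zero h
  exact h1 ▸ (ContinuousLinearMap.isTopCompl_of_proj (dirichletPart_iota h)).symm

theorem P_apply (h : (weakDirichlet q Γ z).IsInvertible) (u : q.H1) :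
    P q Γ z u = u - iota q Γ (dirichletPart q Γ z u) := by
  have hc := isTopCompl_L1 h
  have h1 : u - iota q Γ (dirichletPart q Γ z u) ∈ L1 q Γ z := by
    rw [← dirichletPart_eq_zero h, map_sub, dirichletPart_iota h, sub_self]
  rw [P, dif_pos hc]
  have h2 : (L1 q Γ z).projectionL (H1D q Γ) hc (iota q Γ (dirichletPart q Γ z u)) = 0 :=
    (Submodule.projectionL_apply_eq_zero_iff hc).2 (dirichletPart q Γ z u).2
  conv_lhs => rw [← sub_add_cancel u (iota q Γ (dirichletPart q Γ z u)), map_add]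
  rw [(Submodule.projectionL_eq_self_iff hc _).2 h1, h2, add_zero]

theorem P_mem (h : (weakDirichlet q Γ z).IsInvertible) (u : q.H1) :
    P q Γ z u ∈ L1 q Γ z := by
  rw [P_apply h, ← dirichletPart_eq_zero h, map_sub, dirichletPart_iota h, sub_self]

variable [CompleteSpace H]

theorem weakDirichlet_isInvertible (hz : z ∉ spec (dirichletOp q Γ)) :
    (weakDirichlet q Γ z).IsInvertible := by
  have hin : ∀ u v : H1D q Γ, inner ℂ u v =
      inner ℂ (inclD q Γ u) (inclD q Γ v) + hD q Γ u v := fun u v => q.inner_eq u v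
  exact weakOp_isInvertible_of_notMem_spec (J := inclD q Γ) (a := hD q Γ) inclD_injective
    denseRange_inclD hin hz

theorem weakDirichlet_conj_isInvertible (h : (weakDirichlet q Γ z).IsInvertible) :
    (weakDirichlet q Γ (conj z)).IsInvertible :=
  weakOp_isInvertible_of_conj (a := hDz q Γ z) (b := hDz q Γ (conj z))
    (fun u v => q.hz_conj z u v) h

theorem dualMap_iota_pivot (f : H) : dualMap (iota q Γ) (pivot q.incl f) =
    pivot (inclD q Γ) ((H0D q Γ).orthogonalProjectionOnto f) := by
  ext v
  exact ((H0D q Γ).inner_orthogonalProjectionOnto_eq_of_mem_left (inclD q Γ v) f).symm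

theorem RD_eq (h : (weakDirichlet q Γ z).IsInvertible) :
    RD q Γ z = q.incl ∘L (iota q Γ ∘L wRD q Γ z ∘L dualMap (iota q Γ)) ∘L pivot q.incl := by
  have h1 : resolv (dirichletOp q Γ) z = inclD q Γ ∘L wRD q Γ z ∘L pivot (inclD q Γ) :=
    (isResolvent_of_weakOp_isInvertible (J := inclD q Γ) (a := hD q Γ) inclD_injective
      denseRange_inclD h).resolv_eq
  ext1 f
  simp only [RD, h1, ContinuousLinearMap.comp_apply, dualMap_iota_pivot]
  rfl

theorem toRange_iota (v : H1D q Γ) : toRange Γ (iota q Γ v) = 0 := (toRange_eq_zero Γ).2 v.2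

theorem toRange_P (h : (weakDirichlet q Γ z).IsInvertible) (u : q.H1) :
    toRange Γ (P q Γ z u) = toRange Γ u := by
  rw [P_apply h, map_sub, toRange_iota, sub_zero]

/-! ### Dirichlet solution operators -/

theorem traceOn_isInvertible (h : (weakDirichlet q Γ z).IsInvertible) :
    (traceOn q Γ z).IsInvertible := by
  have hc := isTopCompl_L1 h
  have : CompleteSpace (L1 q Γ z) := hc.isClosed.completeSpace_coe
  apply isInvertible_of_bijective
  constructor
  · refine (injective_iff_map_eq_zero _).2 fun u hu => Subtype.ext ?_
    exact Submodule.disjoint_def.1 hc.isCompl.disjoint u u.2 ((toRange_eq_zero Γ).1 hu)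
  · intro φ
    exact ⟨⟨P q Γ z (sol Γ φ), P_mem h _⟩, (toRange_P h _).trans (toRange_sol Γ φ)⟩

theorem S_mem (φ : GHalf Γ) : S q Γ z φ ∈ L1 q Γ z := ((traceOn q Γ z).inverse φ).2

theorem toRange_S (h : (weakDirichlet q Γ z).IsInvertible) (φ : GHalf Γ) :
    toRange Γ (S q Γ z φ) = φ :=
  (traceOn_isInvertible h).self_apply_inverse φ

theorem S_toRange (h : (weakDirichlet q Γ z).IsInvertible) (u : q.H1) :
    S q Γ z (toRange Γ u) = P q Γ z u := by
  rw [← toRange_P h]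
  exact congrArg Subtype.val
    ((traceOn_isInvertible h).inverse_apply_self ⟨P q Γ z u, P_mem h u⟩)

/-! ### The weak Dirichlet-to-Neumann operator -/

/-- Since `S(z) φ` is a weak solution, `(h - z)(S(z) φ, v)` depends on `v` only through its trace. -/
theorem dualMap_toRange_weakDtN (φ : GHalf Γ) :
    dualMap (toRange Γ) (weakDtN q Γ z φ) = q.weakNeumann z (S q Γ z φ) := by
  ext v
  have h1 : v - sol Γ (toRange Γ v) ∈ H1D q Γ := by
    refine (toRange_eq_zero Γ).1 ?_
    rw [map_sub, toRange_sol, sub_self]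
  have h2 := S_mem (z := z) φ _ h1
  rw [map_sub, sub_apply, sub_eq_zero] at h2
  exact h2.symm

theorem dualMap_toRange_injective : Function.Injective (dualMap (toRange Γ)) := by
  intro l m hlm
  ext φ
  rw [← toRange_sol Γ φ]
  exact congrArg (· (sol Γ φ)) hlm

/-- The inverse of the weak Dirichlet-to-Neumann operator is `Γ R̃ᴺ(z) Γ*`. -/
theorem weakDtN_isInvertible (hD : (weakDirichlet q Γ z).IsInvertible)
    (hN : (q.weakNeumann z).IsInvertible) : (weakDtN q Γ z).IsInvertible := by
  refine ContinuousLinearMap.IsInvertible.of_inverse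
    (g := toRange Γ ∘L q.wRN z ∘L dualMap (toRange Γ)) ?_ ?_
  · ext1 ψ
    apply dualMap_toRange_injective
    simp only [ContinuousLinearMap.comp_apply, ContinuousLinearMap.id_apply]
    set u := q.wRN z (dualMap (toRange Γ) ψ) with hu
    have h1 : q.weakNeumann z u = dualMap (toRange Γ) ψ := hN.self_apply_inverse _
    have h2 : u ∈ L1 q Γ z := by
      rw [mem_L1_iff, h1]
      ext v
      exact (congrArg ψ (toRange_iota v)).trans (map_zero ψ)
    rw [dualMap_toRange_weakDtN, S_toRange hD, P_apply hD, (dirichletPart_eq_zero hD).2 h2,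
      map_zero, sub_zero, h1]
  · ext1 φ
    simp only [ContinuousLinearMap.comp_apply, ContinuousLinearMap.id_apply,
      dualMap_toRange_weakDtN]
    exact (congrArg (toRange Γ) (hN.inverse_apply_self _)).trans (toRange_S hD φ)

/-- Green's identity: `Λ̃(z)` maps the trace of `u` to the functional `(h - z)(u, S(z̄) ·)`. -/
theorem weakDtN_toRange (hD : (weakDirichlet q Γ z).IsInvertible) (u : q.H1) :
    weakDtN q Γ z (toRange Γ u) = dualMap (S q Γ (conj z)) (q.weakNeumann z u) := by
  have hD' := weakDirichlet_conj_isInvertible hD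
  ext ψ
  have h1 := congrArg (· (S q Γ (conj z) ψ)) (dualMap_toRange_weakDtN (z := z) (toRange Γ u))
  simp only [dualMap_apply, toRange_S hD', S_toRange hD, P_apply hD, map_sub, sub_apply] at h1
  -- the contribution of the part of `u` in `ker Γ` vanishes, as `S(z̄) ψ` is in `L¹(z̄)`
  have h2 : q.weakNeumann z (iota q Γ (dirichletPart q Γ z u)) (S q Γ (conj z) ψ) = 0 := by
    have h3 := S_mem (z := conj z) ψ _ (dirichletPart q Γ z u).2
    rw [q.hz_conj] at h3
    exact (map_eq_zero _).1 h3
  rw [h1, h2, sub_zero, dualMap_apply]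

/-! ### Krein's formula -/

omit [CompleteSpace H] in
theorem wRN_sub_wRD (hD : (weakDirichlet q Γ z).IsInvertible)
    (hN : (q.weakNeumann z).IsInvertible) :
    q.wRN z - iota q Γ ∘L wRD q Γ z ∘L dualMap (iota q Γ) = P q Γ z ∘L q.wRN z := by
  ext1 l
  have h1 : q.weakNeumann z (q.wRN z l) = l := hN.self_apply_inverse l
  simp only [sub_apply, ContinuousLinearMap.comp_apply, P_apply hD, dirichletPart, h1]

theorem P_comp_wRN (hD : (weakDirichlet q Γ z).IsInvertible)
    (hN : (q.weakNeumann z).IsInvertible) :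
    P q Γ z ∘L q.wRN z =
      S q Γ z ∘L (weakDtN q Γ z).inverse ∘L dualMap (S q Γ (conj z)) := by
  ext1 l
  have h1 : q.weakNeumann z (q.wRN z l) = l := hN.self_apply_inverse l
  have h2 := weakDtN_toRange hD (q.wRN z l)
  rw [h1] at h2
  simp only [ContinuousLinearMap.comp_apply]
  rw [← h2, (weakDtN_isInvertible hD hN).inverse_apply_self, S_toRange hD]

theorem RN_sub_RD (hD : (weakDirichlet q Γ z).IsInvertible)
    (hN : (q.weakNeumann z).IsInvertible) :
    q.RN z - RD q Γ z = (q.incl ∘L S q Γ z) ∘L (weakDtN q Γ z).inverse ∘L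
      (dualMap (S q Γ (conj z)) ∘L pivot q.incl) := by
  rw [ClosedForm.RN_eq hN, RD_eq hD, ← ContinuousLinearMap.comp_sub,
    ← ContinuousLinearMap.sub_comp, wRN_sub_wRD hD hN, P_comp_wRN hD hN]
  rfl

/-! ### Elliptic regularity -/

/-- `S(z) φ = S φ + (z + 1) R^D(z) S φ` in `H`. -/
theorem incl_S (hD : (weakDirichlet q Γ z).IsInvertible) (φ : GHalf Γ) :
    q.incl (S q Γ z φ) = q.incl (sol Γ φ) + (z + 1) • RD q Γ z (q.incl (sol Γ φ)) := by
  have h1 : dualMap (iota q Γ) (q.weakNeumann z (sol Γ φ)) =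
      -((z + 1) • dualMap (iota q Γ) (pivot q.incl (q.incl (sol Γ φ)))) := by
    ext v
    -- `S φ` is orthogonal to `ker Γ` in `H¹`, that is, a weak solution at `-1`
    have h2 := Submodule.inner_right_of_mem_orthogonal v.2 (sol_mem Γ φ)
    rw [q.inner_eq] at h2
    simp only [dualMap_apply, neg_apply, smul_apply, smul_eq_mul, pivot_apply,
      q.weakNeumann_apply, q.hz_apply]
    change inner ℂ (q.incl (iota q Γ v)) _ + q.h (iota q Γ v) _ = 0 at h2
    linear_combination h2
  have h3 := S_toRange hD (sol Γ φ)
  rw [toRange_sol] at h3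
  rw [h3, P_apply hD, RD_eq hD]
  simp only [dirichletPart, ContinuousLinearMap.comp_apply, h1, map_neg, map_smul, sub_neg_eq_add,
    map_add]

theorem EllipticallyRegular.exists_extension (hE : EllipticallyRegular q Γ) (hΓ : DenseRange Γ)
    (hD : (weakDirichlet q Γ z).IsInvertible) :
    ∃ T : G →L[ℂ] H, ∀ φ : GHalf Γ, T (inclG Γ φ) = q.incl (S q Γ z φ) := by
  obtain ⟨C, -, hC⟩ := hE
  have hbound : ∀ φ : GHalf Γ,
      ‖q.incl (S q Γ z φ)‖ ≤ ((1 + ‖z + 1‖ * ‖RD q Γ z‖) * C) * ‖inclG Γ φ‖ := by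
    intro φ
    rw [incl_S hD]
    calc _ ≤ ‖q.incl (sol Γ φ)‖ + ‖z + 1‖ * (‖RD q Γ z‖ * ‖q.incl (sol Γ φ)‖) := by
          refine (norm_add_le _ _).trans ?_
          rw [norm_smul]
          gcongr
          exact (RD q Γ z).le_opNorm _
      _ = (1 + ‖z + 1‖ * ‖RD q Γ z‖) * ‖q.incl (sol Γ φ)‖ := by ring
      _ ≤ (1 + ‖z + 1‖ * ‖RD q Γ z‖) * (C * ‖inclG Γ φ‖) := by
          gcongr
          exact hC φ
      _ = _ := by ring
  exact ⟨_, LinearMap.extendOfNorm_eq (f := ((q.incl ∘L S q Γ z : GHalf Γ →L[ℂ] H) : _ →ₗ[ℂ] H))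
    (e := (inclG Γ : GHalf Γ →ₗ[ℂ] G)) (denseRange_inclG hΓ) ⟨_, hbound⟩⟩

theorem isResolvent_DtN_zero (hΓ : DenseRange Γ) (h : (weakDtN q Γ z).IsInvertible) :
    IsResolvent (DtN q Γ z) 0 (inclG Γ ∘L (weakDtN q Γ z).inverse ∘L pivot (inclG Γ)) := by
  have h0 : dtnForm q Γ z - (0 : ℂ) • (innerSL ℂ).bilinearComp (inclG Γ) (inclG Γ) =
      dtnForm q Γ z := by
    ext v u
    exact (congrArg (dtnForm q Γ z v u - ·) (zero_mul _)).trans (sub_zero _)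
  have h1 := isResolvent_of_weakOp_isInvertible (z := 0) (a := dtnForm q Γ z)
    (inclG_injective Γ) (denseRange_inclG hΓ) (by rw [h0]; exact h)
  rwa [h0] at h1

end Pair

end BoundaryPairs

end

open BoundaryPairs in
theorem mainTheorem1 {H G : Type*}
    [NormedAddCommGroup H] [InnerProductSpace ℂ H] [CompleteSpace H]
    [NormedAddCommGroup G] [InnerProductSpace ℂ G] [CompleteSpace G]
    (q : ClosedForm H) (Γ : q.H1 →L[ℂ] G) (hΓ : DenseRange Γ)
    (z : ℂ) (hD : z ∉ spec (dirichletOp q Γ)) (hN : z ∉ spec q.neumannOp) :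
    -- all the objects in the formula are well defined
    ((q.weakNeumann z).IsInvertible ∧ (weakDirichlet q Γ z).IsInvertible ∧
      (L1 q Γ z).IsTopCompl (H1D q Γ) ∧
      (traceOn q Γ z).IsInvertible ∧ (traceOn q Γ (starRingEnd ℂ z)).IsInvertible ∧
      (weakDtN q Γ z).IsInvertible) ∧
    -- the weak formula, `H⁻¹ → H¹`
    (q.wRN z - iota q Γ ∘L wRD q Γ z ∘L dualMap (iota q Γ) = P q Γ z ∘L q.wRN z ∧
      P q Γ z ∘L q.wRN z =
        S q Γ z ∘L (weakDtN q Γ z).inverse ∘L dualMap (S q Γ (starRingEnd ℂ z))) ∧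
    -- the formula on `H`
    (q.RN z - RD q Γ z =
      (q.incl ∘L S q Γ z) ∘L (weakDtN q Γ z).inverse ∘L
        (dualMap (S q Γ (starRingEnd ℂ z)) ∘L pivot q.incl)) ∧
    -- the elliptically regular case
    (EllipticallyRegular q Γ →
      ∃ Sz Szbar : G →L[ℂ] H,
        (∀ φ : GHalf Γ, Sz (inclG Γ φ) = q.incl (S q Γ z φ)) ∧
        (∀ φ : GHalf Γ, Szbar (inclG Γ φ) = q.incl (S q Γ (starRingEnd ℂ z) φ)) ∧
        0 ∉ spec (DtN q Γ z) ∧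
        (∀ ψ : G, resolv (DtN q Γ z) 0 ψ =
          inclG Γ ((weakDtN q Γ z).inverse (pivot (inclG Γ) ψ))) ∧
        q.RN z - RD q Γ z =
          Sz ∘L resolv (DtN q Γ z) 0 ∘L ContinuousLinearMap.adjoint Szbar) := by
  have hN' := ClosedForm.weakNeumann_isInvertible hN
  have hD' := weakDirichlet_isInvertible hD
  have hDc := weakDirichlet_conj_isInvertible hD'
  have hL := weakDtN_isInvertible hD' hN'
  refine ⟨⟨hN', hD', isTopCompl_L1 hD', traceOn_isInvertible hD', traceOn_isInvertible hDc, hL⟩,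
    ⟨wRN_sub_wRD hD' hN', P_comp_wRN hD' hN'⟩, RN_sub_RD hD' hN', fun hE => ?_⟩
  obtain ⟨Sz, hSz⟩ := hE.exists_extension hΓ hD'
  obtain ⟨Szbar, hSzbar⟩ := hE.exists_extension hΓ hDc
  have hR := isResolvent_DtN_zero hΓ hL
  refine ⟨Sz, Szbar, hSz, hSzbar, not_not.2 ⟨_, hR⟩, fun ψ => by rw [hR.resolv_eq]; rfl, ?_⟩
  rw [hR.resolv_eq, RN_sub_RD hD' hN']
  -- on `H`, the dual of `S(z̄)` is the Hilbert space adjoint of the extension of `S(z̄)`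
  have hdual : ∀ f : H, dualMap (S q Γ (starRingEnd ℂ z)) (pivot q.incl f) =
      pivot (inclG Γ) (ContinuousLinearMap.adjoint Szbar f) := by
    intro f
    ext φ
    rw [dualMap_apply, pivot_apply, pivot_apply, ContinuousLinearMap.adjoint_inner_right, hSzbar]
  ext f
  simp only [ContinuousLinearMap.comp_apply, hdual, hSz]
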